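/- **Model.** There are $k\ge 1$ stations, attached to a shared channel without collision detection; time is divided into rounds $t=0,1,2,\dots$, and initially all stations sleep. In each round an adaptive adversary, which knows the protocol and the entire history of the preceding rounds (activations, transmissions and successes) but no future random choices, selects a possibly empty set of sleeping stations to be activated in this round; it may leave stations asleep forever. A station activated in round $a$ is in round $i=t-a$ of its local clock in round $t$. In a non-adaptive protocol given by probabilities $p(i)$, $i\ge 1$, each station that was activated in an earlier round and has not yet transmitted successfully transmits in round $i$ of its local clock with probability $p(i)$, independently of all other choices (over stations and over rounds). A station transmits successfully in a round if and only if it is the only station that transmits in that round; it then switches off. **Protocol** $\mathrm{NonAdaptiveWithK}(k,c)$, for a real $c>0$. With logarithms to base $2$, let $L=\lfloor\log\log k\rfloor$ (and $L=0$ for $k=1$), and let $\varphi(l)=k/2^l$ for $0\le l<L$ and $\varphi(L)=k$. After its activation, a station goes through the phases $l=0,1,\dots,L$ in this order; phase $l$ consists of $\lceil c\,\varphi(l)\rceil$ rounds, in each of which the transmission probability is $2^l/(2k)$. After the last phase it does not transmit any more. **Theorem.** For every $\eta>0$ there is $c_0>0$ such that for every $c\ge c_0$ there is a constant $C>0$ (independent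 of $k$ and of the adversary) with the following property. For every $k\ge 1$ and every adaptive adversary, if all stations execute $\mathrm{NonAdaptiveWithK}(k,c)$, then with probability at least $1-1/k^{\eta}$ every station that is activated transmits successfully within $Ck$ rounds of its activation. -/

import Mathlib

/-!
# A shared channel without collision detection, with adversarial wake-up

Rounds of the reference clock are `0, 1, 2, …`; the stations are the elements of `Fin k`.
-/

namespace SharedChannel

/-- The computation history at the beginning of a round.
* `log`: the sets of stations that transmitted in the past rounds, the most recent round first;
  its length is the number of the round that is about to start;
* `activation v`: the round in which `v` was activated, or `none` if `v` still sleeps;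
* `success v`: the round in which `v` transmitted successfully (and switched off upon the
  acknowledgement), or `none` if it has not done so yet. -/
structure History (k : ℕ) where
  log : List (Finset (Fin k))
  activation : Fin k → Option ℕ
  success : Fin k → Option ℕ

/-- The number of the round that is about to start. -/
def History.round {k : ℕ} (h : History k) : ℕ := h.log.length

/-- In the beginning, all stations are sleeping. -/
def History.init (k : ℕ) : History k where
  log := []
  activation := fun _ => none
  success := fun _ => none

/-- An adaptive adversary decides in each round, knowing the whole computation history of the
preceding rounds, which stations to activate in this round. It may leave stations asleep forever.
Stations that have already been activated are not affected. -/
abbrev Adversary (k : ℕ) := History k → Finset (Fin k)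

open Classical in
/-- The set of stations transmitting in the coming round. A station transmits if it is active
(activated in an earlier round, say `a`, and without a successful transmission so far) and its coin
`x v`, uniform in `[0, 1]`, falls below the probability `p i` which the non-adaptive protocol
prescribes for the current round `i = h.round - a` of its local clock. -/
noncomputable def History.transmitters {k : ℕ} (h : History k) (p : ℕ → ℝ)
    (x : Fin k → unitInterval) : Finset (Fin k) :=
  Finset.univ.filter fun v =>
    h.success v = none ∧ ∃ a : ℕ, h.activation v = some a ∧ (x v : ℝ) < p (h.round - a)

open Classical in
/-- One round of the channel. A transmission is successful if and only if there is exactly one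
transmitter. A station activated in this round is in round `0` of its local clock and can
transmit from the next round on. -/
noncomputable def History.next {k : ℕ} (h : History k) (adv : Adversary k) (p : ℕ → ℝ)
    (x : Fin k → unitInterval) : History k where
  log := h.transmitters p x :: h.log
  activation := fun v =>
    if h.activation v = none ∧ v ∈ adv h then some h.round else h.activation v
  success := fun v => if h.transmitters p x = {v} then some h.round else h.success v

/-- The outcomes of the coins: one for every round and every station. -/
abbrev Coins (k : ℕ) := ℕ × Fin k → unitInterval

/-- All coins are independent and uniform in `[0, 1]`. -/
noncomputable def coinMeasure (k : ℕ) : MeasureTheory.Measure (Coins k) :=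
  MeasureTheory.Measure.infinitePi fun _ : ℕ × Fin k =>
    (MeasureTheory.volume : MeasureTheory.Measure unitInterval)

/-- The history of the rounds before round `t`, when all stations use transmission probability
`p i` in round `i` of their local clocks. -/
noncomputable def run {k : ℕ} (adv : Adversary k) (p : ℕ → ℝ) (ω : Coins k) : ℕ → History k
  | 0 => History.init k
  | t + 1 => (run adv p ω t).next adv p fun v => ω (t, v)

/-- The station `v` transmits successfully in round `t`: it is the only transmitter. -/
def SucceedsAt {k : ℕ} (adv : Adversary k) (p : ℕ → ℝ) (ω : Coins k) (v : Fin k) (t : ℕ) : Prop :=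
  (run adv p ω t).transmitters p (fun u => ω (t, u)) = {v}

/-- Every station that is ever activated, in a round `a` say, transmits successfully within `B`
rounds of its activation. -/
def LatencyAtMost {k : ℕ} (adv : Adversary k) (p : ℕ → ℝ) (ω : Coins k) (B : ℝ) : Prop :=
  ∀ (v : Fin k) (t a : ℕ), (run adv p ω t).activation v = some a →
    ∃ i : ℕ, (i : ℝ) ≤ B ∧ SucceedsAt adv p ω v (a + i)

/-! ### The protocol `NonAdaptiveWithK(k, c)` -/

/-- The index `⌊log log k⌋` of the last phase (logarithms to base two). -/
noncomputable def lastPhase (k : ℕ) : ℕ := ⌊Real.logb 2 (Real.logb 2 (k : ℝ))⌋₊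

/-- `φ(l) = k / 2 ^ l` before the last phase, and `φ(l) = k` in the last phase. -/
noncomputable def phi (k l : ℕ) : ℝ := if l < lastPhase k then (k : ℝ) / 2 ^ l else (k : ℝ)

/-- The number `c φ(l)` of rounds of phase `l`, rounded up. -/
noncomputable def phaseLength (k : ℕ) (c : ℝ) (l : ℕ) : ℕ := ⌈c * phi k l⌉₊

/-- The number of rounds spent in the phases before phase `l`. -/
noncomputable def phaseStart (k : ℕ) (c : ℝ) (l : ℕ) : ℕ :=
  ∑ j ∈ Finset.range l, phaseLength k c j

/-- The transmission probability in round `i` of the local clock: `2 ^ l / (2 k)` if the round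
belongs to phase `l`, for `l = 0, …, ⌊log log k⌋`, and `0` in round `0` and after the last
phase. -/
noncomputable def nonAdaptiveWithK (k : ℕ) (c : ℝ) (i : ℕ) : ℝ :=
  ∑ l ∈ Finset.range (lastPhase k + 1),
    if phaseStart k c l < i ∧ i ≤ phaseStart k c (l + 1) then (2 : ℝ) ^ l / (2 * k) else 0

end SharedChannel

/-! Call a round good if the transmission probabilities of all stations sum to at most 2/3. In a
good round a transmitting station is alone with probability at least 1/3, and successes of different
stations are disjoint events. So, whatever the adversary does, a set S of total rate r sees a
success with probability at least r/3. Hence exp(-R/3), where R is the transmission probability that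
S still has ahead, replaced by 0 once a station of S succeeds, is a supermartingale through good
rounds. This gives `measureReal_survivalEvent_le`: all of S survives clock round I through good
rounds with probability at most exp(-|S|(p(0)+...+p(I))/3), although the stations are not
independent.

Each phase adds at least c/2 to the sum of the p(i). For large c, a union bound over the sets of
size ⌈k/8^l⌉ shows that likely none of them outlives the phases before l, and a geometric series
then makes every round good (`sum_rate_run_le`). This is not circular: survival up to a round
presupposes goodness of the earlier rounds only, so induction over rounds applies. Finally, the long
last phase alone adds order c log k, so a union bound over single stations finishes the proof. -/

namespace SharedChannel

open MeasureTheory ProbabilityTheory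
open scoped ENNReal

/-! ### Random recursions driven by fresh coins, and a maximal inequality. -/

section Chain

variable {k : ℕ} {H : Type*}

/-- The trajectory of the random recursion `h ↦ step h x` driven by the coins. -/
def chain (step : H → (Fin k → unitInterval) → H) (h₀ : H) (ω : Coins k) : ℕ → H
  | 0 => h₀
  | t + 1 => step (chain step h₀ ω t) fun v => ω (t, v)

lemma chain_congr (step : H → (Fin k → unitInterval) → H) (h₀ : H) {ω ω' : Coins k} {t : ℕ}
    (hω : ∀ s < t, ∀ v, ω (s, v) = ω' (s, v)) : chain step h₀ ω t = chain step h₀ ω' t := by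
  induction t with
  | zero => rfl
  | succ t ih =>
    rw [chain, chain, ih fun s hs v => hω s (by omega) v]
    congr 1
    ext v
    rw [hω t (by omega)]

instance (k : ℕ) : IsProbabilityMeasure (coinMeasure k) := by
  unfold coinMeasure; infer_instance

lemma map_coins_round (k t : ℕ) :
    (coinMeasure k).map (fun ω v => ω (t, v)) =
      Measure.pi fun _ : Fin k => (volume : Measure unitInterval) := by
  rw [coinMeasure, Measure.map_infinitePi_infinitePi_of_inj (f := fun v : Fin k => (t, v))
    (fun a b h => by simpa using h), Measure.infinitePi_eq_pi]

variable [MeasurableSpace H] [Countable H] [DiscreteMeasurableSpace H]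

lemma measurable_step {step : H → (Fin k → unitInterval) → H}
    (hstep : ∀ h, Measurable (step h)) : Measurable fun z : H × (Fin k → unitInterval) =>
      step z.1 z.2 :=
  (measurable_from_prod_countable_left
    (f := fun z : (Fin k → unitInterval) × H => step z.2 z.1) hstep).comp measurable_swap

lemma measurable_chain {step : H → (Fin k → unitInterval) → H}
    (hstep : ∀ h, Measurable (step h)) (h₀ : H) (t : ℕ) :
    Measurable fun ω : Coins k => chain step h₀ ω t := by
  induction t with
  | zero => exact measurable_const
  | succ t ih => exact (measurable_step hstep).comp (ih.prodMk (by fun_prop))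

/-- The state of the chain is independent of the coins of the coming round. -/
lemma indepFun_chain {step : H → (Fin k → unitInterval) → H}
    (hstep : ∀ h, Measurable (step h)) (h₀ : H) (t : ℕ) :
    IndepFun (fun ω : Coins k => chain step h₀ ω t) (fun ω v => ω (t, v)) (coinMeasure k) := by
  have hind : iIndepFun (fun (i : ℕ × Fin k) (ω : Coins k) => ω i) (coinMeasure k) :=
    iIndepFun_infinitePi (X := fun _ x => x) (by fun_prop)
  let S : Finset (ℕ × Fin k) := Finset.range t ×ˢ Finset.univ
  let T : Finset (ℕ × Fin k) := {t} ×ˢ Finset.univ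
  have hST : Disjoint S T := by
    rw [Finset.disjoint_left]
    rintro ⟨s, v⟩ hs ht
    simp only [S, T, Finset.mem_product, Finset.mem_range, Finset.mem_singleton] at hs ht
    omega
  have h := hind.indepFun_finset S T hST (by fun_prop)
  -- The filler 0 for coins of rounds from `t` on is arbitrary: by `chain_congr` the state before
  -- round `t` ignores them.
  let ext : (S → unitInterval) → Coins k := fun y i => if hi : i ∈ S then y ⟨i, hi⟩ else 0
  have hext : Measurable ext := by
    refine measurable_pi_lambda _ fun i => ?_
    by_cases hi : i ∈ S
    · simp only [ext, hi, dite_true]; fun_prop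
    · simp only [ext, hi, dite_false]; fun_prop
  have hres : Measurable fun (y : T → unitInterval) (v : Fin k) =>
      y ⟨(t, v), by simp [T]⟩ := by fun_prop
  have h' := h.comp ((measurable_chain hstep h₀ t).comp hext) hres
  refine h'.congr (.of_forall fun ω => ?_) (.of_forall fun ω => rfl)
  simp only [Function.comp_apply]
  exact (chain_congr step h₀ fun s hs v => by simp [ext, S, hs]).symm

/-- By independence the joint law of state and coming coins is a product, so the one-step inequality
can be integrated state by state. -/
lemma lintegral_chain_le {step : H → (Fin k → unitInterval) → H}
    (hstep : ∀ h, Measurable (step h)) (h₀ : H) (Φ : H → ℝ≥0∞)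
    (hΦ : ∀ h, ∫⁻ x, Φ (step h x) ∂(Measure.pi fun _ => volume) ≤ Φ h) (t : ℕ) :
    ∫⁻ ω, Φ (chain step h₀ ω t) ∂(coinMeasure k) ≤ Φ h₀ := by
  induction t with
  | zero => simp [chain]
  | succ t ih =>
    refine le_trans ?_ ih
    have hX := measurable_chain hstep h₀ t
    have hY : Measurable fun (ω : Coins k) (v : Fin k) => ω (t, v) := by fun_prop
    have hF : Measurable fun z : H × (Fin k → unitInterval) => Φ (step z.1 z.2) :=
      (Measurable.of_discrete (f := Φ)).comp (measurable_step hstep)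
    have hmap := (indepFun_iff_map_prod_eq_prod_map_map hX.aemeasurable hY.aemeasurable).1
      (indepFun_chain hstep h₀ t)
    calc ∫⁻ ω, Φ (chain step h₀ ω (t + 1)) ∂(coinMeasure k)
        = ∫⁻ z, Φ (step z.1 z.2) ∂((coinMeasure k).map
            fun ω => (chain step h₀ ω t, fun v => ω (t, v))) := by
          rw [lintegral_map hF (hX.prodMk hY)]; rfl
      _ = ∫⁻ h, ∫⁻ x, Φ (step h x) ∂(Measure.pi fun _ => volume)
            ∂((coinMeasure k).map fun ω => chain step h₀ ω t) := by
          rw [hmap, map_coins_round, lintegral_prod _ hF.aemeasurable]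
      _ ≤ ∫⁻ h, Φ h ∂((coinMeasure k).map fun ω => chain step h₀ ω t) :=
          lintegral_mono hΦ
      _ = ∫⁻ ω, Φ (chain step h₀ ω t) ∂(coinMeasure k) :=
          lintegral_map Measurable.of_discrete hX

/-- A maximal inequality: if the potential `Φ` is a supermartingale as long as the chain is in `G`
and has not reached `E`, and `Φ` is at least `1` on `E`, then `E` is reached through `G` with
probability at most `Φ h₀`. -/
lemma measure_exists_chain_mem_le {step : H → (Fin k → unitInterval) → H}
    (hstep : ∀ h, Measurable (step h)) (h₀ : H) (Φ : H → ℝ≥0∞) (E G : Set H)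
    (hE : ∀ h ∈ E, 1 ≤ Φ h)
    (hΦ : ∀ h ∈ G, h ∉ E → ∫⁻ x, Φ (step h x) ∂(Measure.pi fun _ => volume) ≤ Φ h) :
    coinMeasure k {ω | ∃ t, chain step h₀ ω t ∈ E ∧ ∀ s < t, chain step h₀ ω s ∈ G} ≤ Φ h₀ := by
  classical
  -- Stopping on leaving `G` or reaching `E` makes `Φ` a supermartingale everywhere and `E`
  -- absorbing. The events of being in `E` at time `t` then increase, so the bound passes to their
  -- union.
  let freeze : H → (Fin k → unitInterval) → H := fun h x => if h ∈ G \ E then step h x else h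
  have hfreeze : ∀ h, Measurable (freeze h) := fun h => by
    by_cases hh : h ∈ G \ E
    · simp only [freeze, hh, if_true]; exact hstep h
    · simp only [freeze, hh, if_false]; exact measurable_const
  have hsuper : ∀ h, ∫⁻ x, Φ (freeze h x) ∂(Measure.pi fun _ => volume) ≤ Φ h := fun h => by
    by_cases hh : h ∈ G \ E
    · simp only [freeze, hh, if_true]; exact hΦ h hh.1 hh.2
    · simp only [freeze, hh, if_false]; simp
  have hbound : ∀ t, coinMeasure k {ω | chain freeze h₀ ω t ∈ E} ≤ Φ h₀ := fun t => by
    have hmeas : Measurable fun ω : Coins k => Φ (chain freeze h₀ ω t) :=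
      (Measurable.of_discrete (f := Φ)).comp (measurable_chain hfreeze h₀ t)
    calc coinMeasure k {ω | chain freeze h₀ ω t ∈ E}
        ≤ coinMeasure k {ω | 1 ≤ Φ (chain freeze h₀ ω t)} := measure_mono fun ω hω => hE _ hω
      _ ≤ ∫⁻ ω, Φ (chain freeze h₀ ω t) ∂(coinMeasure k) := by
          simpa using mul_meas_ge_le_lintegral (μ := coinMeasure k) hmeas 1
      _ ≤ Φ h₀ := lintegral_chain_le hfreeze h₀ Φ hsuper t
  have habs : ∀ ω t, chain freeze h₀ ω t ∈ E → chain freeze h₀ ω (t + 1) ∈ E := fun ω t h => by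
    rw [chain, show ∀ x, freeze (chain freeze h₀ ω t) x = chain freeze h₀ ω t from
      fun x => if_neg fun h' => h'.2 h]
    exact h
  have hmono : Monotone fun t => {ω : Coins k | chain freeze h₀ ω t ∈ E} :=
    monotone_nat_of_le_succ fun t ω h => habs ω t h
  have hsub : {ω : Coins k | ∃ t, chain step h₀ ω t ∈ E ∧ ∀ s < t, chain step h₀ ω s ∈ G} ⊆
      ⋃ t, {ω | chain freeze h₀ ω t ∈ E} := by
    rintro ω ⟨t, ht, hG⟩
    have key : ∀ s ≤ t, (∃ r, chain freeze h₀ ω r ∈ E) ∨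
        chain freeze h₀ ω s = chain step h₀ ω s := by
      intro s
      induction s with
      | zero => exact fun _ => Or.inr rfl
      | succ s ih =>
        intro hs
        rcases ih (by omega) with h | h
        · exact Or.inl h
        · by_cases hsE : chain step h₀ ω s ∈ E
          · exact Or.inl ⟨s, h ▸ hsE⟩
          · right
            rw [chain, chain, h]
            simp [freeze, hsE, hG s (by omega)]
    rcases key t le_rfl with ⟨r, hr⟩ | h
    · exact Set.mem_iUnion.2 ⟨r, hr⟩
    · exact Set.mem_iUnion.2 ⟨t, by simpa [h] using ht⟩
  calc _ ≤ coinMeasure k (⋃ t, {ω | chain freeze h₀ ω t ∈ E}) := measure_mono hsub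
    _ = ⨆ t, coinMeasure k {ω | chain freeze h₀ ω t ∈ E} := hmono.measure_iUnion
    _ ≤ Φ h₀ := iSup_le hbound

end Chain

end SharedChannel

namespace SharedChannel

open MeasureTheory ProbabilityTheory
open scoped ENNReal

/-! ### Success probabilities in a single round. -/

section Histories

variable {k : ℕ}

/-- Countability allows the discrete σ-algebra on histories, so arbitrary adversaries raise no
measurability question. -/
instance (k : ℕ) : Countable (History k) :=
  Function.Injective.countable
    (f := fun h : History k => (h.log, h.activation, h.success)) fun h h' hh => by
      cases h; cases h'; simpa using hh

instance (k : ℕ) : MeasurableSpace (History k) := ⊤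

instance (k : ℕ) : DiscreteMeasurableSpace (History k) := ⟨fun _ => trivial⟩

lemma run_eq_chain (adv : Adversary k) (p : ℕ → ℝ) (ω : Coins k) (t : ℕ) :
    run adv p ω t = chain (fun h x => h.next adv p x) (History.init k) ω t := by
  induction t with
  | zero => rfl
  | succ t ih => rw [run, chain, ih]

open Classical in
/-- The probability with which the station `v` transmits in the coming round. -/
noncomputable def History.rate (h : History k) (p : ℕ → ℝ) (v : Fin k) : ℝ :=
  if h.success v = none then (h.activation v).elim 0 fun a => p (h.round - a) else 0

lemma History.rate_nonneg (h : History k) {p : ℕ → ℝ} (hp : ∀ i, 0 ≤ p i) (v : Fin k) :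
    0 ≤ h.rate p v := by
  unfold History.rate
  split_ifs
  · cases h.activation v <;> simp [hp]
  · rfl

lemma History.mem_transmitters (h : History k) (p : ℕ → ℝ) (x : Fin k → unitInterval)
    (v : Fin k) : v ∈ h.transmitters p x ↔ (x v : ℝ) < h.rate p v := by
  have hx : ¬ (x v : ℝ) < 0 := not_lt.2 (x v).2.1
  unfold History.transmitters History.rate
  by_cases hs : h.success v = none
  · cases ha : h.activation v <;> simp [hs, ha, hx]
  · simp [hs, hx]

/-- The event is a box in the coins of the round, so its probability is a product. -/
lemma History.transmitters_eq_singleton (h : History k) (p : ℕ → ℝ) (v : Fin k) :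
    {x | h.transmitters p x = {v}} = Set.univ.pi fun u =>
      if u = v then {y : unitInterval | (y : ℝ) < h.rate p u}
      else {y : unitInterval | h.rate p u ≤ y} := by
  ext x
  simp only [Set.mem_ofPred_eq, Finset.ext_iff, Finset.mem_singleton, h.mem_transmitters,
    Set.mem_univ_pi]
  refine forall_congr' fun u => ?_
  split_ifs with huv <;> simp [huv]

lemma measurableSet_transmitters_eq_singleton (h : History k) (p : ℕ → ℝ) (v : Fin k) :
    MeasurableSet {x | h.transmitters p x = {v}} := by
  rw [h.transmitters_eq_singleton]
  refine MeasurableSet.univ_pi fun u => ?_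
  split_ifs
  · exact measurableSet_lt (by fun_prop) (by fun_prop)
  · exact measurableSet_le (by fun_prop) (by fun_prop)

lemma measurable_transmitters (h : History k) (p : ℕ → ℝ) :
    Measurable[_, ⊤] fun x => h.transmitters p x := by
  let _ : MeasurableSpace (Finset (Fin k)) := ⊤
  refine measurable_to_countable' fun A => ?_
  have : (fun x => h.transmitters p x) ⁻¹' {A} =
      ⋂ u, {x | (x u : ℝ) < h.rate p u ↔ u ∈ A} := by
    ext x
    simp [Finset.ext_iff, h.mem_transmitters]
  rw [this]
  refine MeasurableSet.iInter fun u => ?_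
  by_cases hu : u ∈ A
  · simp only [hu, iff_true]; exact measurableSet_lt (by fun_prop) (by fun_prop)
  · simp only [hu, iff_false, not_lt]; exact measurableSet_le (by fun_prop) (by fun_prop)

lemma measurable_next (adv : Adversary k) (p : ℕ → ℝ) (h : History k) :
    Measurable fun x => h.next adv p x := by
  classical
  let _ : MeasurableSpace (Finset (Fin k)) := ⊤
  let f : Finset (Fin k) → History k := fun A => ⟨A :: h.log, fun v =>
    if h.activation v = none ∧ v ∈ adv h then some h.round else h.activation v,
    fun v => if A = {v} then some h.round else h.success v⟩
  have hf : Measurable f := measurable_from_top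
  have := hf.comp (measurable_transmitters h p)
  convert this using 1
  ext x
  simp only [History.next, Function.comp_apply, f]

lemma one_sub_sum_le_prod_one_sub {ι : Type*} (s : Finset ι) (r : ι → ℝ)
    (h0 : ∀ i ∈ s, 0 ≤ r i) (h1 : ∀ i ∈ s, r i ≤ 1) :
    1 - ∑ i ∈ s, r i ≤ ∏ i ∈ s, (1 - r i) := by
  classical
  induction s using Finset.induction_on with
  | empty => simp
  | insert a s ha ih =>
    rw [Finset.sum_insert ha, Finset.prod_insert ha]
    have h0a := h0 a (by simp)
    have h1a := h1 a (by simp)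
    have ih' := ih (fun i hi => h0 i (by simp [hi])) fun i hi => h1 i (by simp [hi])
    have hs : 0 ≤ ∑ i ∈ s, r i := Finset.sum_nonneg fun i hi => h0 i (by simp [hi])
    nlinarith [mul_nonneg h0a hs, mul_le_mul_of_nonneg_left ih' (sub_nonneg.2 h1a)]

/-- A station transmits successfully with at least a third of its transmission probability, if
the transmission probabilities sum up to at most `2 / 3`. -/
lemma le_measureReal_transmitters_eq_singleton (h : History k) {p : ℕ → ℝ} (hp : ∀ i, 0 ≤ p i)
    (hG : ∑ v, h.rate p v ≤ 2 / 3) (v : Fin k) :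
    h.rate p v / 3 ≤
      (Measure.pi fun _ : Fin k => (volume : Measure unitInterval)).real
        {x | h.transmitters p x = {v}} := by
  have h0 := h.rate_nonneg hp
  have h1 : ∀ u, h.rate p u ≤ 1 := fun u =>
    (Finset.single_le_sum (fun i _ => h0 i) (Finset.mem_univ u)).trans (by linarith)
  rw [h.transmitters_eq_singleton, Measure.real, Measure.pi_pi, ENNReal.toReal_prod]
  have hvol : ∀ u : Fin k, (volume (if u = v then {y : unitInterval | (y : ℝ) < h.rate p u}
      else {y : unitInterval | h.rate p u ≤ y})).toReal =
      if u = v then h.rate p u else 1 - h.rate p u := fun u => by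
    split_ifs
    · rw [show {y : unitInterval | (y : ℝ) < h.rate p u} =
        Set.Iio (⟨h.rate p u, h0 u, h1 u⟩ : unitInterval) from rfl, unitInterval.volume_Iio,
        ENNReal.toReal_ofReal (h0 u)]
    · rw [show {y : unitInterval | h.rate p u ≤ (y : ℝ)} =
        Set.Ici (⟨h.rate p u, h0 u, h1 u⟩ : unitInterval) from rfl, unitInterval.volume_Ici,
        ENNReal.toReal_ofReal (sub_nonneg.2 (h1 u))]
  simp_rw [hvol]
  rw [← Finset.mul_prod_erase _ _ (Finset.mem_univ v), if_pos rfl,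
    Finset.prod_congr rfl (g := fun u => 1 - h.rate p u)
      fun u hu => if_neg (Finset.ne_of_mem_erase hu)]
  have hsum : ∑ u ∈ Finset.univ.erase v, h.rate p u ≤ 2 / 3 :=
    (Finset.sum_le_sum_of_subset_of_nonneg (Finset.erase_subset _ _)
      fun i _ _ => h0 i).trans hG
  have := one_sub_sum_le_prod_one_sub (Finset.univ.erase v) (h.rate p) (fun i _ => h0 i)
    fun i _ => h1 i
  rw [div_eq_mul_inv]
  exact mul_le_mul_of_nonneg_left (by linarith) (h0 v)

/-- At most one station can be the sole transmitter, so the individual bounds add up. -/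
lemma sum_rate_le_measureReal (h : History k) {p : ℕ → ℝ} (hp : ∀ i, 0 ≤ p i)
    (hG : ∑ v, h.rate p v ≤ 2 / 3) (S : Finset (Fin k)) :
    (∑ v ∈ S, h.rate p v) / 3 ≤
      (Measure.pi fun _ : Fin k => (volume : Measure unitInterval)).real
        (⋃ v ∈ S, {x | h.transmitters p x = {v}}) := by
  rw [measureReal_biUnion_finset]
  · rw [Finset.sum_div]
    exact Finset.sum_le_sum fun v _ => le_measureReal_transmitters_eq_singleton h hp hG v
  · intro u _ v _ huv
    refine Set.disjoint_left.2 fun x (hu : _ = _) (hv : _ = _) => huv ?_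
    simpa using hu.symm.trans hv
  · exact fun v _ => measurableSet_transmitters_eq_singleton h p v

end Histories

/-! ### The exponential potential and the survival bound. -/

section Survival

variable {k : ℕ}

/-- All stations of `S` are active after more than `I` rounds of their local clocks. -/
def Survivors (S : Finset (Fin k)) (I : ℕ) : Set (History k) :=
  {h | ∀ v ∈ S, h.success v = none ∧ ∃ a, h.activation v = some a ∧ I < h.round - a}

/-- The transmission probability that remains to a station up to round `I` of its local clock. -/
noncomputable def History.remaining (h : History k) (p : ℕ → ℝ) (I : ℕ) (v : Fin k) : ℝ :=
  ∑ i ∈ Finset.Ico ((h.activation v).elim 0 fun a => h.round - a) (I + 1), p i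

open Classical in
/-- An upper bound for the probability that the stations of `S` survive `I` rounds of their local
clocks. -/
noncomputable def potential (p : ℕ → ℝ) (S : Finset (Fin k)) (I : ℕ) (h : History k) : ℝ :=
  if ∀ v ∈ S, h.success v = none then Real.exp (-(∑ v ∈ S, h.remaining p I v) / 3) else 0

/-- One round uses up no more of the remaining sum than the current rate. -/
lemma remaining_le_next (adv : Adversary k) {p : ℕ → ℝ} (hp : ∀ i, 0 ≤ p i) (hp0 : p 0 = 0)
    (I : ℕ) (h : History k) (x : Fin k → unitInterval) {v : Fin k} (hv : h.success v = none) :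
    h.remaining p I v ≤ (h.next adv p x).remaining p I v + h.rate p v := by
  have hround : (h.next adv p x).round = h.round + 1 := rfl
  have step : ∀ j, ∑ i ∈ Finset.Ico j (I + 1), p i ≤
      ∑ i ∈ Finset.Ico (j + 1) (I + 1), p i + p j := fun j => by
    rcases lt_or_ge j (I + 1) with hj | hj
    · rw [Finset.sum_eq_sum_Ico_succ_bot hj]; linarith
    · rw [Finset.Ico_eq_empty (by omega), Finset.Ico_eq_empty (by omega)]; simp [hp]
  unfold History.remaining History.rate
  rw [hround]
  cases ha : h.activation v with
  | none =>
    by_cases hadv : v ∈ adv h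
    · simpa [History.next, ha, hv, hadv, hp0] using step 0
    · simp [History.next, ha, hv, hadv]
  | some a =>
    simp only [History.next, ha, hv, Option.elim_some, if_true, reduceCtorEq, false_and, if_false]
    rcases le_or_gt a h.round with hle | hlt
    · rw [Nat.sub_add_comm hle]; exact step _
    -- For an arbitrary history `a` may lie in the future; truncated subtraction then keeps the
    -- clock at 0.
    · rw [show h.round - a = 0 by omega, show h.round + 1 - a = 0 by omega, hp0]; simp

lemma potential_next_le (adv : Adversary k) {p : ℕ → ℝ} (hp : ∀ i, 0 ≤ p i) (hp0 : p 0 = 0)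
    (S : Finset (Fin k)) (I : ℕ) (h : History k) (x : Fin k → unitInterval) :
    potential p S I (h.next adv p x) ≤
      (⋃ v ∈ S, {x | h.transmitters p x = {v}})ᶜ.indicator
        (fun _ => potential p S I h * Real.exp ((∑ v ∈ S, h.rate p v) / 3)) x := by
  classical
  have hnonneg : 0 ≤ potential p S I h := by unfold potential; split_ifs <;> positivity
  by_cases hnext : ∀ v ∈ S, (h.next adv p x).success v = none
  · have hx : ∀ v ∈ S, h.transmitters p x ≠ {v} := fun v hv hvx => by
      simpa [History.next, hvx] using hnext v hv
    have hs : ∀ v ∈ S, h.success v = none := fun v hv => by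
      simpa [History.next, hx v hv] using hnext v hv
    rw [Set.indicator_of_mem (by simpa using hx), potential, if_pos hnext, potential, if_pos hs,
      ← Real.exp_add]
    refine Real.exp_le_exp.2 ?_
    have := Finset.sum_le_sum fun v hv => remaining_le_next adv hp hp0 I h x (hs v hv)
    rw [Finset.sum_add_distrib] at this
    linarith
  · rw [potential, if_neg hnext]
    exact Set.indicator_nonneg (fun _ _ => by positivity) _

/-- With y a third of the total rate of `S`, the potential grows at most by the factor exp(y), and
is nonzero with probability at most 1 - y ≤ exp(-y). -/
lemma lintegral_potential_le (adv : Adversary k) {p : ℕ → ℝ} (hp : ∀ i, 0 ≤ p i) (hp0 : p 0 = 0)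
    (S : Finset (Fin k)) (I : ℕ) (h : History k) (hG : ∑ v, h.rate p v ≤ 2 / 3) :
    ∫⁻ x, ENNReal.ofReal (potential p S I (h.next adv p x))
      ∂(Measure.pi fun _ => volume) ≤ ENNReal.ofReal (potential p S I h) := by
  classical
  set A : Set (Fin k → unitInterval) := ⋃ v ∈ S, {x | h.transmitters p x = {v}} with hA
  have hAm : MeasurableSet A := Finset.measurableSet_biUnion _ fun v _ =>
    measurableSet_transmitters_eq_singleton h p v
  have hnonneg : 0 ≤ potential p S I h := by unfold potential; split_ifs <;> positivity
  set y := (∑ v ∈ S, h.rate p v) / 3 with hy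
  set μ : Measure (Fin k → unitInterval) := Measure.pi fun _ => volume with hμ
  calc ∫⁻ x, ENNReal.ofReal (potential p S I (h.next adv p x)) ∂μ
      ≤ ∫⁻ x, Aᶜ.indicator (fun _ => ENNReal.ofReal (potential p S I h * Real.exp y)) x ∂μ := by
        refine lintegral_mono fun x => ?_
        refine (ENNReal.ofReal_le_ofReal (potential_next_le adv hp hp0 S I h x)).trans ?_
        rw [← hA, ← hy]
        by_cases hx : x ∈ Aᶜ <;> simp [hx]
    _ = ENNReal.ofReal (potential p S I h * Real.exp y) * ENNReal.ofReal (μ.real Aᶜ) := by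
        rw [lintegral_indicator_const hAm.compl, ofReal_measureReal]
    _ ≤ ENNReal.ofReal (potential p S I h) := by
        rw [← ENNReal.ofReal_mul (by positivity)]
        refine ENNReal.ofReal_le_ofReal ?_
        have h1 : μ.real Aᶜ ≤ Real.exp (-y) := by
          rw [probReal_compl_eq_one_sub hAm]
          have := sum_rate_le_measureReal h hp hG S
          have := Real.add_one_le_exp (-y)
          linarith
        calc potential p S I h * Real.exp y * μ.real Aᶜ
            ≤ potential p S I h * Real.exp y * Real.exp (-y) := by gcongr
          _ = potential p S I h := by rw [mul_assoc, ← Real.exp_add]; simp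

/-- The event that the stations of `S` survive `I` rounds of their local clocks, while the
transmission probabilities sum up to at most `2 / 3` in every round. -/
def survivalEvent (adv : Adversary k) (p : ℕ → ℝ) (S : Finset (Fin k)) (I : ℕ) : Set (Coins k) :=
  {ω | ∃ t, run adv p ω t ∈ Survivors S I ∧
    ∀ s < t, ∑ v, (run adv p ω s).rate p v ≤ 2 / 3}

lemma measureReal_survivalEvent_le (adv : Adversary k) {p : ℕ → ℝ} (hp : ∀ i, 0 ≤ p i)
    (hp0 : p 0 = 0) (S : Finset (Fin k)) (I : ℕ) :
    (coinMeasure k).real (survivalEvent adv p S I) ≤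
      Real.exp (-(S.card * ∑ i ∈ Finset.range (I + 1), p i) / 3) := by
  have h := measure_exists_chain_mem_le (measurable_next adv p) (History.init k)
    (fun h => ENNReal.ofReal (potential p S I h)) (Survivors S I)
    {h | ∑ v, h.rate p v ≤ 2 / 3} (fun h hh => ?_)
    (fun h hG _ => lintegral_potential_le adv hp hp0 S I h hG)
  · simp only [← run_eq_chain] at h
    refine ENNReal.toReal_le_of_le_ofReal (Real.exp_nonneg _) (h.trans (le_of_eq ?_))
    congr 1
    rw [potential, if_pos (show ∀ v ∈ S, (History.init k).success v = none from fun _ _ => rfl)]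
    simp [History.remaining, History.init]
  · rw [potential, if_pos fun v hv => (hh v hv).1, Finset.sum_eq_zero]
    · simp
    · intro v hv
      obtain ⟨-, a, ha, hI⟩ := hh v hv
      rw [History.remaining, ha, Option.elim_some, Finset.Ico_eq_empty (by omega)]
      simp

end Survival

end SharedChannel

namespace SharedChannel

/-! ### From survival events to latency, for a fixed outcome of the coins. -/

section Deterministic

variable {k : ℕ} {adv : Adversary k} {p : ℕ → ℝ} {ω : Coins k}

lemma round_run (adv : Adversary k) (p : ℕ → ℝ) (ω : Coins k) (t : ℕ) :
    (run adv p ω t).round = t := by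
  induction t with
  | zero => rfl
  | succ t ih => simpa [run, History.next, History.round] using ih

lemma lt_of_activation_run {v : Fin k} {t a : ℕ} (h : (run adv p ω t).activation v = some a) :
    a < t := by
  induction t with
  | zero => simp [run, History.init] at h
  | succ t ih =>
    rw [run, History.next] at h
    dsimp only at h
    split_ifs at h
    · rw [round_run, Option.some.injEq] at h; omega
    · exact (ih h).trans (Nat.lt_succ_self t)

lemma activation_run_mono {v : Fin k} {s t a : ℕ} (hst : s ≤ t)
    (h : (run adv p ω s).activation v = some a) : (run adv p ω t).activation v = some a := by
  induction t, hst using Nat.le_induction with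
  | base => exact h
  | succ t _ ih => simp [run, History.next, ih]

lemma succeedsAt_of_success_run {v : Fin k} {s t : ℕ}
    (h : (run adv p ω t).success v = some s) : s < t ∧ SucceedsAt adv p ω v s := by
  induction t with
  | zero => simp [run, History.init] at h
  | succ t ih =>
    rw [run, History.next] at h
    dsimp only at h
    split_ifs at h with hv
    · rw [round_run, Option.some.injEq] at h
      subst h
      exact ⟨Nat.lt_succ_self _, hv⟩
    · exact ⟨(ih h).1.trans (Nat.lt_succ_self t), (ih h).2⟩

lemma activation_of_succeedsAt {v : Fin k} {s : ℕ} (h : SucceedsAt adv p ω v s) :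
    ∃ a, (run adv p ω s).activation v = some a := by
  have hv : v ∈ (run adv p ω s).transmitters p (fun u => ω (s, u)) := by rw [h]; simp
  unfold History.transmitters at hv
  obtain ⟨-, -, a, ha, -⟩ := Finset.mem_filter.1 hv
  exact ⟨a, ha⟩

/-- If the transmission probabilities always sum up to at most `2 / 3` and no station survives
`I` rounds of its local clock, then the latency is at most `I`. -/
lemma latencyAtMost_of_notMem_survivalEvent {I : ℕ} {B : ℝ} (hIB : (I : ℝ) ≤ B)
    (hG : ∀ t, ∑ v, (run adv p ω t).rate p v ≤ 2 / 3)
    (hI : ∀ v, ω ∉ survivalEvent adv p {v} I) : LatencyAtMost adv p ω B := by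
  intro v t a ha
  have hact : (run adv p ω (a + I + 1)).activation v = some a := by
    have hlt := lt_of_activation_run ha
    refine activation_run_mono (s := a + 1) (by omega) ?_
    -- The activation is traced back from `t` to `a + 1`: a later activation would record a round
    -- other than `a`.
    induction t, (Nat.succ_le_of_lt hlt) using Nat.le_induction with
    | base => exact ha
    | succ t hat ih =>
      refine ih ?_ hat
      rw [run, History.next] at ha
      dsimp only at ha
      split_ifs at ha
      · rw [round_run, Option.some.injEq] at ha; omega
      · exact ha
  cases hs : (run adv p ω (a + I + 1)).success v with
  | none =>
    refine absurd ⟨a + I + 1, fun u hu => ?_, fun s _ => hG s⟩ (hI v)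
    rw [Finset.mem_singleton.1 hu]
    exact ⟨hs, a, hact, by rw [round_run]; omega⟩
  | some s =>
    obtain ⟨hlt, hsucc⟩ := succeedsAt_of_success_run hs
    obtain ⟨a', ha'⟩ := activation_of_succeedsAt hsucc
    have h1 := activation_run_mono hlt.le ha'
    rw [hact, Option.some.injEq] at h1
    subst h1
    have h2 := lt_of_activation_run ha'
    refine ⟨s - a, le_trans (by exact_mod_cast (by omega : s - a ≤ I)) hIB, ?_⟩
    rwa [Nat.add_sub_cancel' h2.le]

end Deterministic

/-! ### Phase lengths, accumulated probabilities and the sum of the rates. -/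

section Protocol

variable {k : ℕ} {c : ℝ}

lemma nonAdaptiveWithK_nonneg (k : ℕ) (c : ℝ) (i : ℕ) : 0 ≤ nonAdaptiveWithK k c i :=
  Finset.sum_nonneg fun l _ => by split_ifs <;> positivity

lemma nonAdaptiveWithK_zero (k : ℕ) (c : ℝ) : nonAdaptiveWithK k c 0 = 0 := by
  simp [nonAdaptiveWithK]

lemma phaseStart_mono (k : ℕ) (c : ℝ) : Monotone (phaseStart k c) := fun _ _ h =>
  Finset.sum_le_sum_of_subset (Finset.range_subset_range.2 h)

/-- The transmission probabilities in the first `l` phases sum up to at least the contribution of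
these phases. -/
lemma sum_phases_le_sum_nonAdaptiveWithK {l : ℕ} (hl : l ≤ lastPhase k + 1) :
    ∑ j ∈ Finset.range l, (phaseLength k c j : ℝ) * (2 ^ j / (2 * k)) ≤
      ∑ i ∈ Finset.range (phaseStart k c l + 1), nonAdaptiveWithK k c i := by
  unfold nonAdaptiveWithK
  rw [Finset.sum_comm]
  calc ∑ j ∈ Finset.range l, (phaseLength k c j : ℝ) * (2 ^ j / (2 * k))
      ≤ ∑ j ∈ Finset.range l, ∑ i ∈ Finset.range (phaseStart k c l + 1),
          if phaseStart k c j < i ∧ i ≤ phaseStart k c (j + 1) then (2 : ℝ) ^ j / (2 * k)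
          else 0 := by
        refine Finset.sum_le_sum fun j hj => ?_
        have hle : phaseStart k c (j + 1) ≤ phaseStart k c l :=
          phaseStart_mono k c (Finset.mem_range.1 hj)
        rw [← Finset.sum_filter, Finset.sum_const, nsmul_eq_mul]
        have hcard : phaseLength k c j = (Finset.Ioc (phaseStart k c j)
            (phaseStart k c (j + 1))).card := by
          rw [Nat.card_Ioc, phaseStart, phaseStart, Finset.sum_range_succ]; simp
        rw [hcard]
        gcongr
        intro i hi
        simp only [Finset.mem_Ioc, Finset.mem_filter, Finset.mem_range] at hi ⊢
        omega
    _ ≤ _ := by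
        refine Finset.sum_le_sum_of_subset_of_nonneg (Finset.range_subset_range.2 hl)
          fun j _ _ => Finset.sum_nonneg fun i _ => ?_
        split_ifs <;> positivity

lemma le_phi (k l : ℕ) : (k : ℝ) / 2 ^ l ≤ phi k l := by
  unfold phi
  split_ifs
  · rfl
  · exact div_le_self (by positivity) (one_le_pow₀ (by norm_num))

lemma mul_phi_le_phaseLength (k : ℕ) (c : ℝ) (l : ℕ) : c * phi k l ≤ phaseLength k c l :=
  Nat.le_ceil _

lemma half_le_phaseLength_mul (hk : 1 ≤ k) (hc : 0 ≤ c) (j : ℕ) :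
    c / 2 ≤ phaseLength k c j * (2 ^ j / (2 * k)) := by
  have hk' : (0 : ℝ) < k := by exact_mod_cast hk
  calc c / 2 = c * (k / 2 ^ j) * (2 ^ j / (2 * k)) := by field_simp
    _ ≤ _ := by
      gcongr
      exact (mul_le_mul_of_nonneg_left (le_phi k j) hc).trans (mul_phi_le_phaseLength k c j)

lemma le_sum_nonAdaptiveWithK (hk : 1 ≤ k) (hc : 0 ≤ c) {l : ℕ} (hl : l ≤ lastPhase k + 1) :
    l * (c / 2) ≤ ∑ i ∈ Finset.range (phaseStart k c l + 1), nonAdaptiveWithK k c i := by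
  refine le_trans ?_ (sum_phases_le_sum_nonAdaptiveWithK hl)
  calc l * (c / 2) = ∑ j ∈ Finset.range l, c / 2 := by simp
    _ ≤ _ := Finset.sum_le_sum fun j _ => half_le_phaseLength_mul hk hc j

/-- The last phase alone suffices: its length is at least ck rather than ck/2^L. -/
lemma le_sum_nonAdaptiveWithK_all (hk : 1 ≤ k) :
    c * 2 ^ lastPhase k / 2 ≤
      ∑ i ∈ Finset.range (phaseStart k c (lastPhase k + 1) + 1), nonAdaptiveWithK k c i := by
  have hk' : (0 : ℝ) < k := by exact_mod_cast hk
  refine le_trans ?_ (sum_phases_le_sum_nonAdaptiveWithK le_rfl)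
  rw [Finset.sum_range_succ]
  have h0 : (0 : ℝ) ≤ ∑ j ∈ Finset.range (lastPhase k),
      (phaseLength k c j : ℝ) * (2 ^ j / (2 * k)) := Finset.sum_nonneg fun _ _ => by positivity
  have h1 : c * 2 ^ lastPhase k / 2 ≤
      phaseLength k c (lastPhase k) * (2 ^ lastPhase k / (2 * k)) := by
    calc c * 2 ^ lastPhase k / 2 = c * k * (2 ^ lastPhase k / (2 * k)) := by field_simp
      _ ≤ _ := by
        gcongr
        simpa [phi] using mul_phi_le_phaseLength k c (lastPhase k)
  linarith

/-- The shrinking phases cost at most 2ck, the last one ck, and rounding up at most 1 per phase. -/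
lemma phaseStart_lastPhase_add_one_le (hc : 0 ≤ c) :
    (phaseStart k c (lastPhase k + 1) : ℝ) ≤ 3 * c * k + (lastPhase k + 1) := by
  have hgeo : ∀ n : ℕ, ∑ l ∈ Finset.range n, (k : ℝ) / 2 ^ l ≤ 2 * k := fun n => by
    have := sum_geometric_two_le n
    calc ∑ l ∈ Finset.range n, (k : ℝ) / 2 ^ l
        = k * ∑ l ∈ Finset.range n, (1 / 2 : ℝ) ^ l := by
          rw [Finset.mul_sum]; simp [div_eq_mul_inv]
      _ ≤ k * 2 := by gcongr
      _ = 2 * k := mul_comm _ _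
  have hphi : ∀ l, 0 ≤ phi k l := fun l => le_trans (by positivity) (le_phi k l)
  have hsum : ∑ l ∈ Finset.range (lastPhase k + 1), phi k l ≤ 3 * k := by
    rw [Finset.sum_range_succ, Finset.sum_congr rfl (g := fun l => (k : ℝ) / 2 ^ l)
      fun l hl => by rw [phi, if_pos (Finset.mem_range.1 hl)]]
    have := hgeo (lastPhase k)
    have : phi k (lastPhase k) = k := by simp [phi]
    linarith
  calc (phaseStart k c (lastPhase k + 1) : ℝ)
      = ∑ l ∈ Finset.range (lastPhase k + 1), (phaseLength k c l : ℝ) := by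
        rw [phaseStart]; push_cast; rfl
    _ ≤ ∑ l ∈ Finset.range (lastPhase k + 1), (c * phi k l + 1) :=
        Finset.sum_le_sum fun l _ => (Nat.ceil_lt_add_one (mul_nonneg hc (hphi l))).le
    _ = c * ∑ l ∈ Finset.range (lastPhase k + 1), phi k l + (lastPhase k + 1) := by
        rw [Finset.sum_add_distrib, Finset.mul_sum]; simp
    _ ≤ c * (3 * k) + (lastPhase k + 1) := by gcongr
    _ = _ := by ring

/-- If, for every `l ≥ 1`, less than `k / 8 ^ l` stations survive the phases before phase `l`,
then the transmission probabilities sum up to at most `2 / 3` in every round. -/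
lemma sum_rate_run_le (hk : 1 ≤ k) {adv : Adversary k} {ω : Coins k}
    (hω : ∀ l, 1 ≤ l → l ≤ lastPhase k → ∀ S : Finset (Fin k), S.card = ⌈(k : ℝ) / 8 ^ l⌉₊ →
      ω ∉ survivalEvent adv (nonAdaptiveWithK k c) S (phaseStart k c l)) (t : ℕ) :
    ∑ v, (run adv (nonAdaptiveWithK k c) ω t).rate (nonAdaptiveWithK k c) v ≤ 2 / 3 := by
  classical
  have hk' : (0 : ℝ) < k := by exact_mod_cast hk
  induction t using Nat.strong_induction_on with
  | _ t ih =>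
    set h := run adv (nonAdaptiveWithK k c) ω t with hh
    let N : ℕ → Finset (Fin k) := fun l => Finset.univ.filter fun v =>
      h.success v = none ∧ ∃ a, h.activation v = some a ∧ phaseStart k c l < h.round - a
    have hN : ∀ l ≤ lastPhase k, ((N l).card : ℝ) ≤ k / 8 ^ l := fun l hl => by
      rcases Nat.eq_zero_or_pos l with rfl | hl0
      · simpa using Finset.card_le_univ (N 0)
      · by_contra hlt
        obtain ⟨S, hSN, hS⟩ := Finset.exists_subset_card_eq (Nat.ceil_le.2 (not_le.1 hlt).le)
        -- The induction hypothesis is precisely the goodness of earlier rounds that the survival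
        -- event demands.
        exact hω l hl0 hl S hS ⟨t, fun v hv => (Finset.mem_filter.1 (hSN hv)).2, ih⟩
    -- A station is also charged for the phases it has completed; the geometric decay absorbs this
    -- overcount.
    have hrate : ∀ v, h.rate (nonAdaptiveWithK k c) v ≤ ∑ l ∈ Finset.range (lastPhase k + 1),
        if v ∈ N l then (2 : ℝ) ^ l / (2 * k) else 0 := fun v => by
      have h0 : (0 : ℝ) ≤ ∑ l ∈ Finset.range (lastPhase k + 1),
          if v ∈ N l then (2 : ℝ) ^ l / (2 * k) else 0 :=
        Finset.sum_nonneg fun l _ => by split_ifs <;> positivity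
      unfold History.rate
      split_ifs with hs
      · cases ha : h.activation v with
        | none => exact h0
        | some a =>
          rw [Option.elim_some, nonAdaptiveWithK]
          refine Finset.sum_le_sum fun l _ => ?_
          by_cases hl : phaseStart k c l < h.round - a ∧ h.round - a ≤ phaseStart k c (l + 1)
          · rw [if_pos hl, if_pos (Finset.mem_filter.2 ⟨Finset.mem_univ v, hs, a, ha, hl.1⟩)]
          · rw [if_neg hl]; split_ifs <;> positivity
      · exact h0
    calc ∑ v, h.rate (nonAdaptiveWithK k c) v
        ≤ ∑ v, ∑ l ∈ Finset.range (lastPhase k + 1),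
            if v ∈ N l then (2 : ℝ) ^ l / (2 * k) else 0 := Finset.sum_le_sum fun v _ => hrate v
      _ = ∑ l ∈ Finset.range (lastPhase k + 1), (N l).card * ((2 : ℝ) ^ l / (2 * k)) := by
          rw [Finset.sum_comm]
          simp
      _ ≤ ∑ l ∈ Finset.range (lastPhase k + 1), (1 / 2) * (1 / 4 : ℝ) ^ l := by
          refine Finset.sum_le_sum fun l hl => ?_
          calc (N l).card * ((2 : ℝ) ^ l / (2 * k)) ≤ k / 8 ^ l * ((2 : ℝ) ^ l / (2 * k)) := by
                gcongr; exact hN l (Nat.lt_succ_iff.1 (Finset.mem_range.1 hl))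
            _ = (1 / 2) * (1 / 4 : ℝ) ^ l := by
                rw [show (8 : ℝ) = 2 * 4 by norm_num, mul_pow, one_div_pow]; field_simp
      _ ≤ 2 / 3 := by
          rw [← Finset.mul_sum, geom_sum_eq (by norm_num)]
          have : (0 : ℝ) ≤ (1 / 4) ^ (lastPhase k + 1) := by positivity
          norm_num
          linarith

end Protocol

end SharedChannel

namespace SharedChannel

/-! ### Estimates for binomial coefficients and logarithms. -/

section Bounds

lemma choose_mul_pow_le (n m : ℕ) {x : ℝ} (hx : 0 ≤ x) : n.choose m * x ^ m ≤ (1 + x) ^ n := by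
  rcases lt_or_ge n m with h | h
  · rw [Nat.choose_eq_zero_of_lt h]; simp; positivity
  · rw [add_comm, add_pow]
    refine le_trans ?_ (Finset.single_le_sum (fun i _ => by positivity)
      (Finset.mem_range.2 (Nat.lt_succ_of_le h)))
    simp [mul_comm]

/-- One term of the binomial expansion of (1 + 8^(-l))^k is at most exp(k/8^l) ≤ exp(m); undoing the
weight costs 8^(lm) ≤ exp(3lm). -/
lemma choose_le_exp {k l m : ℕ} (hl : 1 ≤ l) (hm : (k : ℝ) / 8 ^ l ≤ m) :
    (k.choose m : ℝ) ≤ Real.exp (4 * l * m) := by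
  have h1 : (k.choose m : ℝ) * (1 / 8 ^ l) ^ m ≤ Real.exp m :=
    calc (k.choose m : ℝ) * (1 / 8 ^ l) ^ m ≤ (1 + 1 / 8 ^ l) ^ k :=
          choose_mul_pow_le k m (by positivity)
      _ ≤ Real.exp (1 / 8 ^ l) ^ k := by
          gcongr
          rw [add_comm]
          exact Real.add_one_le_exp _
      _ = Real.exp (k / 8 ^ l) := by rw [← Real.exp_nat_mul]; congr 1; ring
      _ ≤ Real.exp m := Real.exp_le_exp.2 hm
  have h8 : (8 : ℝ) ≤ Real.exp 3 := by
    have h2 : (2 : ℝ) ≤ Real.exp 1 := by have := Real.add_one_le_exp (1 : ℝ); linarith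
    calc (8 : ℝ) = 2 ^ 3 := by norm_num
      _ ≤ Real.exp 1 ^ 3 := by gcongr
      _ = Real.exp 3 := by rw [← Real.exp_nat_mul]; norm_num
  have hl' : (1 : ℝ) ≤ l := by exact_mod_cast hl
  calc (k.choose m : ℝ) = k.choose m * (1 / 8 ^ l) ^ m * (8 ^ l) ^ m := by
        rw [mul_assoc, ← mul_pow, one_div_mul_cancel (by positivity), one_pow, mul_one]
    _ ≤ Real.exp m * (Real.exp 3 ^ l) ^ m := by gcongr
    _ = Real.exp (m + 3 * l * m) := by
        rw [← Real.exp_nat_mul, ← Real.exp_nat_mul, ← Real.exp_add]; congr 1; ring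
    _ ≤ Real.exp (4 * l * m) := by
        refine Real.exp_le_exp.2 ?_
        nlinarith [mul_nonneg (sub_nonneg.2 hl') (Nat.cast_nonneg (α := ℝ) m)]

lemma two_pow_lastPhase_le {k : ℕ} (hk : 2 ≤ k) : (2 : ℝ) ^ lastPhase k ≤ Real.logb 2 k := by
  have hk' : (2 : ℝ) ≤ k := by exact_mod_cast hk
  have hx : 1 ≤ Real.logb 2 (k : ℝ) := by
    rw [Real.le_logb_iff_rpow_le (by norm_num) (by linarith)]; simpa using hk'
  rw [← Real.rpow_natCast, ← Real.le_logb_iff_rpow_le (by norm_num) (by linarith)]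
  exact Nat.floor_le (Real.logb_nonneg (by norm_num) hx)

lemma logb_le_two_pow_lastPhase {k : ℕ} (hk : 2 ≤ k) :
    Real.logb 2 k ≤ 2 * (2 : ℝ) ^ lastPhase k := by
  have hk' : (2 : ℝ) ≤ k := by exact_mod_cast hk
  have hx : 0 < Real.logb 2 (k : ℝ) := Real.logb_pos (by norm_num) (by linarith)
  have h : Real.logb 2 (Real.logb 2 (k : ℝ)) ≤ ((lastPhase k + 1 : ℕ) : ℝ) := by
    push_cast; exact (Nat.lt_floor_add_one _).le
  rw [Real.logb_le_iff_le_rpow (by norm_num) hx, Real.rpow_natCast, pow_succ] at h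
  linarith

lemma log_le_logb_two {x : ℝ} (hx : 1 ≤ x) : Real.log x ≤ Real.logb 2 x := by
  have h2 := Real.log_two_lt_d9
  rw [Real.logb, le_div_iff₀ (Real.log_pos (by norm_num))]
  exact mul_le_of_le_one_right (Real.log_nonneg hx) (by linarith)

lemma logb_two_le_two_mul_log {x : ℝ} (hx : 1 ≤ x) : Real.logb 2 x ≤ 2 * Real.log x := by
  have h2 := Real.log_two_gt_d9
  rw [Real.logb, div_le_iff₀ (Real.log_pos (by norm_num))]
  nlinarith [Real.log_nonneg hx]

lemma lastPhase_add_one_le {k : ℕ} (hk : 2 ≤ k) : lastPhase k + 1 ≤ k := by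
  have hk' : (1 : ℝ) ≤ k := by exact_mod_cast (by omega : 1 ≤ k)
  have h1 : (2 : ℝ) ^ lastPhase k ≤ k := by
    refine (two_pow_lastPhase_le hk).trans ?_
    rw [Real.logb_le_iff_le_rpow (by norm_num) (by linarith), Real.rpow_natCast]
    exact_mod_cast Nat.lt_two_pow_self.le
  have h2 : lastPhase k < 2 ^ lastPhase k := Nat.lt_two_pow_self
  have h3 : 2 ^ lastPhase k ≤ k := by exact_mod_cast h1
  omega

/-- The number of survivors at which the union bound of phase `l` is applied is logarithmic. -/
lemma log_le_div_eight_pow {k l : ℕ} (hk : 2 ≤ k) (hl : l ≤ lastPhase k) :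
    Real.log k / 192 ≤ (k : ℝ) / 8 ^ l := by
  have hk' : (2 : ℝ) ≤ k := by exact_mod_cast hk
  set y := Real.log k with hy
  have hy0 : 0 < y := Real.log_pos (by linarith)
  -- This is y^4/4! ≤ exp(y) = k; together with 8^l ≤ 8y^3 it yields 192 = 8 · 24.
  have h4 : y ^ 4 ≤ 24 * k := by
    have := Real.pow_div_factorial_le_exp y hy0.le 4
    rw [hy, Real.exp_log (by linarith), ← hy] at this
    norm_num [Nat.factorial] at this
    linarith
  have h8 : (8 : ℝ) ^ l ≤ 8 * y ^ 3 :=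
    calc (8 : ℝ) ^ l ≤ 8 ^ lastPhase k := pow_le_pow_right₀ (by norm_num) hl
      _ = (2 ^ lastPhase k) ^ 3 := by rw [← pow_mul, mul_comm, pow_mul]; norm_num
      _ ≤ (2 * y) ^ 3 := by
          gcongr
          exact (two_pow_lastPhase_le hk).trans (logb_two_le_two_mul_log (by linarith))
      _ = 8 * y ^ 3 := by ring
  rw [div_le_div_iff₀ (by norm_num) (by positivity)]
  calc y * 8 ^ l ≤ y * (8 * y ^ 3) := by gcongr
    _ = 8 * y ^ 4 := by ring
    _ ≤ k * 192 := by linarith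

end Bounds

/-! ### Union bounds over sets of survivors and over single stations. -/

section UnionBound

open MeasureTheory

variable {k : ℕ} {c η : ℝ}

/-- Each set survives with probability at most exp(-lmc/6), against at most exp(4lm) sets. As m ≥
(log k)/192, the condition on `c` leaves the exponent (η + 2) log k. -/
lemma measureReal_iUnion_survivalEvent_phase_le (hk : 2 ≤ k) (hη : 0 < η)
    (hc : 6 * (192 * (η + 2) + 4) ≤ c) (adv : Adversary k) {l : ℕ} (hl : 1 ≤ l)
    (hlL : l ≤ lastPhase k) :
    (coinMeasure k).real (⋃ S ∈ Finset.powersetCard ⌈(k : ℝ) / 8 ^ l⌉₊ Finset.univ,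
      survivalEvent adv (nonAdaptiveWithK k c) S (phaseStart k c l)) ≤
      Real.exp (-((η + 2) * Real.log k)) := by
  set m := ⌈(k : ℝ) / 8 ^ l⌉₊ with hm
  have hmk : (k : ℝ) / 8 ^ l ≤ m := Nat.le_ceil _
  have hmy := (log_le_div_eight_pow hk hlL).trans hmk
  have hl' : (1 : ℝ) ≤ l := by exact_mod_cast hl
  have hc0 : 0 ≤ c := le_trans (by positivity) hc
  have hevent : ∀ S ∈ Finset.powersetCard m (Finset.univ : Finset (Fin k)),
      (coinMeasure k).real (survivalEvent adv (nonAdaptiveWithK k c) S (phaseStart k c l)) ≤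
        Real.exp (-(m * (l * (c / 2))) / 3) := fun S hS => by
    refine (measureReal_survivalEvent_le adv (nonAdaptiveWithK_nonneg k c)
      (nonAdaptiveWithK_zero k c) S _).trans (Real.exp_le_exp.2 ?_)
    rw [(Finset.mem_powersetCard.1 hS).2]
    have := mul_le_mul_of_nonneg_left (le_sum_nonAdaptiveWithK (k := k) (by omega) hc0
      (by omega : l ≤ lastPhase k + 1)) (Nat.cast_nonneg (α := ℝ) m)
    linarith
  calc _ ≤ ∑ S ∈ Finset.powersetCard m (Finset.univ : Finset (Fin k)), (coinMeasure k).real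
          (survivalEvent adv (nonAdaptiveWithK k c) S (phaseStart k c l)) :=
        measureReal_biUnion_finset_le _ _
    _ ≤ ∑ _S ∈ Finset.powersetCard m (Finset.univ : Finset (Fin k)),
          Real.exp (-(m * (l * (c / 2))) / 3) := Finset.sum_le_sum hevent
    _ = k.choose m * Real.exp (-(m * (l * (c / 2))) / 3) := by simp
    _ ≤ Real.exp (4 * l * m) * Real.exp (-(m * (l * (c / 2))) / 3) := by
        gcongr; exact choose_le_exp hl hmk
    _ = Real.exp (-(l * (m * (c / 6 - 4)))) := by rw [← Real.exp_add]; congr 1; ring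
    _ ≤ Real.exp (-((η + 2) * Real.log k)) := by
        refine Real.exp_le_exp.2 (neg_le_neg ?_)
        calc (η + 2) * Real.log k = Real.log k / 192 * (192 * (η + 2)) := by ring
          _ ≤ m * (c / 6 - 4) := by gcongr; linarith
          _ ≤ l * (m * (c / 6 - 4)) := by
            refine le_mul_of_one_le_left (mul_nonneg (Nat.cast_nonneg _) ?_) hl'
            linarith

lemma measureReal_survivalEvent_singleton_le (hk : 2 ≤ k) (hη : 0 < η)
    (hc : 12 * (η + 2) ≤ c) (adv : Adversary k) (v : Fin k) :
    (coinMeasure k).real (survivalEvent adv (nonAdaptiveWithK k c) {v}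
      (phaseStart k c (lastPhase k + 1))) ≤ Real.exp (-((η + 2) * Real.log k)) := by
  refine (measureReal_survivalEvent_le adv (nonAdaptiveWithK_nonneg k c)
    (nonAdaptiveWithK_zero k c) {v} _).trans (Real.exp_le_exp.2 ?_)
  have h1 := le_sum_nonAdaptiveWithK_all (k := k) (c := c) (by omega)
  have hk' : (1 : ℝ) ≤ k := by exact_mod_cast (by omega : 1 ≤ k)
  have h2 := (log_le_logb_two hk').trans (logb_le_two_pow_lastPhase hk)
  have hy := Real.log_nonneg hk'
  have h3 : 12 * (η + 2) * Real.log k ≤ c * (2 * 2 ^ lastPhase k) :=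
    mul_le_mul hc h2 hy (le_trans (by positivity) hc)
  rw [Finset.card_singleton, Nat.cast_one, one_mul]
  linarith

lemma two_mul_mul_exp_neg_log_le (hk : 2 ≤ k) :
    2 * k * Real.exp (-((η + 2) * Real.log k)) ≤ 1 / (k : ℝ) ^ η := by
  have hk' : (2 : ℝ) ≤ k := by exact_mod_cast hk
  have hk0 : (0 : ℝ) < k := by linarith
  have h : Real.exp (-((η + 2) * Real.log k)) = 1 / (k : ℝ) ^ η / (k * k) := by
    rw [Real.rpow_def_of_pos hk0, one_div, ← Real.exp_neg]
    have : (k : ℝ) * k = Real.exp (2 * Real.log k) := by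
      rw [two_mul, Real.exp_add, Real.exp_log hk0]
    rw [this, ← Real.exp_sub]
    congr 1
    ring
  rw [h, mul_div_assoc', div_le_iff₀ (by positivity)]
  have : 0 < 1 / (k : ℝ) ^ η := by positivity
  calc 2 * k * (1 / (k : ℝ) ^ η) = 1 / (k : ℝ) ^ η * (2 * k) := by ring
    _ ≤ 1 / (k : ℝ) ^ η * (k * k) := by gcongr

lemma le_measureReal_latencyAtMost (hk : 2 ≤ k) (hη : 0 < η)
    (hc : 6 * (192 * (η + 2) + 4) ≤ c) (adv : Adversary k) :
    1 - 1 / (k : ℝ) ^ η ≤ (coinMeasure k).real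
      {ω | LatencyAtMost adv (nonAdaptiveWithK k c) ω ((3 * c + 1) * k)} := by
  have hc0 : 0 ≤ c := le_trans (by positivity) hc
  have hk1 : 1 ≤ k := by omega
  set δ := Real.exp (-((η + 2) * Real.log k)) with hδ
  set A := {ω | LatencyAtMost adv (nonAdaptiveWithK k c) ω ((3 * c + 1) * k)}
  set B : Set (Coins k) := ⋃ l ∈ Finset.Icc 1 (lastPhase k),
    ⋃ S ∈ Finset.powersetCard ⌈(k : ℝ) / 8 ^ l⌉₊ Finset.univ,
      survivalEvent adv (nonAdaptiveWithK k c) S (phaseStart k c l)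
  set D : Set (Coins k) := ⋃ v ∈ (Finset.univ : Finset (Fin k)),
    survivalEvent adv (nonAdaptiveWithK k c) {v} (phaseStart k c (lastPhase k + 1))
  have hB : (coinMeasure k).real B ≤ k * δ := by
    calc (coinMeasure k).real B ≤ ∑ l ∈ Finset.Icc 1 (lastPhase k), _ :=
          measureReal_biUnion_finset_le _ _
      _ ≤ ∑ _l ∈ Finset.Icc 1 (lastPhase k), δ := Finset.sum_le_sum fun l hl =>
          measureReal_iUnion_survivalEvent_phase_le hk hη hc adv (Finset.mem_Icc.1 hl).1
            (Finset.mem_Icc.1 hl).2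
      _ = lastPhase k * δ := by simp
      _ ≤ k * δ := by
          gcongr
          exact (Nat.le_succ _).trans (lastPhase_add_one_le hk)
  have hD : (coinMeasure k).real D ≤ k * δ := by
    calc (coinMeasure k).real D ≤ ∑ v ∈ (Finset.univ : Finset (Fin k)), _ :=
          measureReal_biUnion_finset_le _ _
      _ ≤ ∑ _v ∈ (Finset.univ : Finset (Fin k)), δ := Finset.sum_le_sum fun v _ =>
          measureReal_survivalEvent_singleton_le hk hη (by linarith) adv v
      _ = k * δ := by simp
  have hcover : Set.univ ⊆ A ∪ (B ∪ D) := fun ω _ => by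
    by_contra hω
    simp only [Set.mem_union, not_or] at hω
    obtain ⟨hA, hB, hD⟩ := hω
    refine hA (latencyAtMost_of_notMem_survivalEvent
      (I := phaseStart k c (lastPhase k + 1)) ?_ (sum_rate_run_le hk1 fun l hl hlL S hS h => ?_)
      fun v h => ?_)
    · have h1 := phaseStart_lastPhase_add_one_le (k := k) hc0
      -- The rounding of the phase lengths is absorbed by the summand 1 in 3c + 1.
      have h2 : (lastPhase k + 1 : ℝ) ≤ k := by exact_mod_cast lastPhase_add_one_le hk
      linarith
    · refine hB (Set.mem_biUnion (Finset.mem_Icc.2 ⟨hl, hlL⟩) (Set.mem_biUnion ?_ h))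
      exact Finset.mem_powersetCard.2 ⟨Finset.subset_univ S, hS⟩
    · exact hD (Set.mem_biUnion (Finset.mem_univ v) h)
  have h1 : 1 ≤ (coinMeasure k).real A + (coinMeasure k).real (B ∪ D) :=
    calc (1 : ℝ) = (coinMeasure k).real Set.univ := by simp
      _ ≤ (coinMeasure k).real (A ∪ (B ∪ D)) := measureReal_mono hcover
      _ ≤ _ := measureReal_union_le _ _
  have h2 := measureReal_union_le (μ := coinMeasure k) B D
  have h3 := two_mul_mul_exp_neg_log_le (η := η) hk
  linarith

end UnionBound

end SharedChannel

theorem theorem3p1 (η : ℝ) (hη : 0 < η) :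
    ∃ c₀ : ℝ, 0 < c₀ ∧ ∀ c : ℝ, c₀ ≤ c →
      ∃ C : ℝ, 0 < C ∧ ∀ k : ℕ, 1 ≤ k → ∀ adv : SharedChannel.Adversary k,
        1 - 1 / (k : ℝ) ^ η ≤
          (SharedChannel.coinMeasure k).real
            {ω | SharedChannel.LatencyAtMost adv (SharedChannel.nonAdaptiveWithK k c) ω
              (C * k)} := by
  refine ⟨6 * (192 * (η + 2) + 4), by positivity, fun c hc => ⟨3 * c + 1, ?_, fun k hk adv => ?_⟩⟩
  · linarith
  · rcases hk.eq_or_lt with rfl | hk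
    · simp
    · exact SharedChannel.le_measureReal_latencyAtMost hk hη hc adv
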